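/- Let $\kappa\le\lambda$ be cardinals with $\kappa>0$. Write $P_\kappa\lambda$ for the set of subsets of $\lambda$ of size less than $\kappa$. The cardinal $\kappa$ is *$\lambda$-supercompact* if $\kappa$ is uncountable and there is a normal fine measure on $P_\kappa\lambda$, that is, a $\kappa$-complete ultrafilter $U$ on $P_\kappa\lambda$ such that $\{s : a\in s\}\in U$ for every $a\in\lambda$, and such that every function $f:P_\kappa\lambda\to\lambda$ with $\{s : f(s)\in s\}\in U$ is constant on a set in $U$. For a cardinal $\mu\ge\kappa$, the cardinal $\kappa$ is *second-order $\mu$-reflective* if, for every structure $M$ of size $\mu$ with $\kappa\subseteq M$ in a first-order language with fewer than $\kappa$ symbols, every second-order sentence $\varphi$ (in full second-order semantics, with quantifiers over relations of any finite arity) that is true in $M$ is also true in some first-order elementary substructure $m\prec M$ of size less than $\kappa$ with $m\cap\kappa\in\kappa$. It is *$\mu$-reflective for $\Pi^1_1$ assertions* if this holds for all $\Pi^1_1$ sentences $\varphi$, i.e. those consisting of a finite block of universal second-order quantifiers followed by a formula without second-order quantifiers. Then: 1. If $\kappa$ is $\lambda$-supercompact, then $\kappa$ is second-order $\lambda$-reflective.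 2. If $\kappa$ is $2^{\lambda^{<\kappa}}$-reflective for $\Pi^1_1$ assertions, then $\kappa$ is $\lambda$-supercompact. -/

import Mathlib

universe u v w

open Cardinal

/-- De Bruijn style relation variables: `RelVar Γ k` is the type of `k`-ary relation variables
in a context `Γ`, the list of the arities of the relation variables in scope. -/
inductive RelVar : List ℕ → ℕ → Type
  | zero {Γ : List ℕ} {k : ℕ} : RelVar (k :: Γ) k
  | succ {Γ : List ℕ} {k l : ℕ} (X : RelVar Γ k) : RelVar (l :: Γ) k

/-- Assignments of relations on `M` to the relation variables of the context `Γ`. -/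
def RelAssignment (M : Type w) (Γ : List ℕ) : Type w :=
  ∀ k : ℕ, RelVar Γ k → Set (Fin k → M)

/-- The assignment for the empty context. -/
def RelAssignment.empty (M : Type w) : RelAssignment M [] :=
  fun _ X => nomatch X

/-- Extend an assignment by a value for one new (innermost) relation variable. -/
def RelAssignment.cons {M : Type w} {Γ : List ℕ} {l : ℕ} (A : Set (Fin l → M))
    (V : RelAssignment M Γ) : RelAssignment M (l :: Γ)
  | _, .zero => A
  | k, .succ X => V k X

/-- Formulas of second-order logic over the language `L`, with free individual variables indexed
by `Fin n` and free relation variables given by the context `Γ`. The relation variables may have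
any finite arity. The other connectives and quantifiers are the usual abbreviations. -/
inductive SOFormula (L : FirstOrder.Language.{u, v}) : List ℕ → ℕ → Type (max u v)
  | falsum {Γ : List ℕ} {n : ℕ} : SOFormula L Γ n
  | equal {Γ : List ℕ} {n : ℕ} (t₁ t₂ : L.Term (Fin n)) : SOFormula L Γ n
  | rel {Γ : List ℕ} {n k : ℕ} (R : L.Relations k) (ts : Fin k → L.Term (Fin n)) :
      SOFormula L Γ n
  | var {Γ : List ℕ} {n k : ℕ} (X : RelVar Γ k) (ts : Fin k → L.Term (Fin n)) :
      SOFormula L Γ n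
  | imp {Γ : List ℕ} {n : ℕ} (φ ψ : SOFormula L Γ n) : SOFormula L Γ n
  | all {Γ : List ℕ} {n : ℕ} (φ : SOFormula L Γ (n + 1)) : SOFormula L Γ n
  | allRel {Γ : List ℕ} {n : ℕ} (k : ℕ) (φ : SOFormula L (k :: Γ) n) : SOFormula L Γ n

namespace SOFormula

variable {L : FirstOrder.Language.{u, v}}

/-- Satisfaction in full second-order semantics: the relation quantifier of arity `k` ranges over
all `k`-ary relations on `M`. -/
def Realize (M : Type w) [L.Structure M] :
    {Γ : List ℕ} → {n : ℕ} → SOFormula L Γ n → RelAssignment M Γ → (Fin n → M) → Prop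
  | _, _, falsum, _, _ => False
  | _, _, equal t₁ t₂, _, v => t₁.realize v = t₂.realize v
  | _, _, rel R ts, _, v => FirstOrder.Language.Structure.RelMap R fun i => (ts i).realize v
  | _, _, var X ts, V, v => (fun i => (ts i).realize v) ∈ V _ X
  | _, _, imp φ ψ, V, v => φ.Realize M V v → ψ.Realize M V v
  | _, _, all φ, V, v => ∀ x : M, φ.Realize M V (Fin.snoc v x)
  | _, _, allRel k φ, V, v => ∀ A : Set (Fin k → M), φ.Realize M (V.cons A) v

/-- The formula contains no second-order quantifier (relation variables may occur free). -/
def IsFirstOrder : {Γ : List ℕ} → {n : ℕ} → SOFormula L Γ n → Prop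
  | _, _, imp φ ψ => φ.IsFirstOrder ∧ ψ.IsFirstOrder
  | _, _, all φ => φ.IsFirstOrder
  | _, _, allRel _ _ => False
  | _, _, _ => True

/-- `Π¹₁` formulas: a finite (possibly empty) block of universal second-order quantifiers followed
by a formula without second-order quantifiers. -/
inductive IsPi11 : {Γ : List ℕ} → {n : ℕ} → SOFormula L Γ n → Prop
  | of_isFirstOrder {Γ : List ℕ} {n : ℕ} {φ : SOFormula L Γ n} (h : φ.IsFirstOrder) : IsPi11 φ
  | allRel {Γ : List ℕ} {n : ℕ} (k : ℕ) {φ : SOFormula L (k :: Γ) n} (h : IsPi11 φ) :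
      IsPi11 (SOFormula.allRel k φ)

end SOFormula

/-- Second-order sentences: no free variables of either kind. -/
abbrev SOSentence (L : FirstOrder.Language.{u, v}) : Type (max u v) := SOFormula L [] 0

/-- Truth of a second-order sentence in a structure. -/
def SOSentence.Holds {L : FirstOrder.Language.{u, v}} (φ : SOSentence L) (M : Type w) [L.Structure M] : Prop :=
  SOFormula.Realize M φ (RelAssignment.empty M) Fin.elim0

/-- Reflection at `κ`, for structures of size `μ`, of the second-order sentences in the class `C`.

Up to renaming the elements of `M`, the requirement `κ ⊆ M` is an injection `e` into `M` of the
initial ordinal `κ`, and `m ∩ κ ∈ κ` says that the ordinals below `κ` that lie in `m` are exactly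
the ordinals below some `β < κ`. -/
def ReflectsAt (κ μ : Cardinal.{u}) (C : ∀ L : FirstOrder.Language.{u, u}, SOSentence L → Prop) : Prop :=
  ∀ (L : FirstOrder.Language.{u, u}), L.card < κ →
  ∀ (M : Type u) [L.Structure M], #M = μ →
  ∀ (e : κ.ord.ToType ↪ M) (φ : SOSentence L), C L φ → φ.Holds M →
    ∃ m : L.ElementarySubstructure M,
      φ.Holds m ∧ #m < κ ∧ ∃ β : κ.ord.ToType, ∀ α : κ.ord.ToType, e α ∈ m ↔ α < β

/-- `κ` is second-order `μ`-reflective. -/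
def IsSecondOrderReflective (κ μ : Cardinal.{u}) : Prop :=
  ReflectsAt κ μ fun _ _ => True

/-- `κ` is `μ`-reflective for `Π¹₁` assertions. -/
def IsPi11Reflective (κ μ : Cardinal.{u}) : Prop :=
  ReflectsAt κ μ fun _ φ => SOFormula.IsPi11 φ

/-- `P_κ λ`, the set of all subsets of `λ` of size less than `κ`. -/
abbrev PKappa (κ lam : Cardinal.{u}) : Type u :=
  {s : Set lam.ord.ToType // #s < κ}

/-- A normal fine measure on `P_κ λ`: a `κ`-complete ultrafilter that is fine and for which every
function that is regressive on a measure-one set is constant on a measure-one set. -/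
structure IsNormalFineMeasure (κ lam : Cardinal.{u}) (U : Ultrafilter (PKappa κ lam)) : Prop where
  complete : CardinalInterFilter (U : Filter (PKappa κ lam)) κ
  fine : ∀ a : lam.ord.ToType, ∀ᶠ s : PKappa κ lam in U, a ∈ s.1
  normal : ∀ f : PKappa κ lam → lam.ord.ToType,
    (∀ᶠ s : PKappa κ lam in U, f s ∈ s.1) → ∃ a, ∀ᶠ s : PKappa κ lam in U, f s = a

/-- `κ` is `λ`-supercompact (for a cardinal `λ ≥ κ`): `κ` is uncountable and there is a normal fine
measure on `P_κ λ`. -/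
def IsSupercompact (κ lam : Cardinal.{u}) : Prop :=
  ℵ₀ < κ ∧ ∃ U : Ultrafilter (PKappa κ lam), IsNormalFineMeasure κ lam U

/-!
Both directions work directly with a normal fine measure `U` on `P_κ λ`; no ultrapower is formed.

**Supercompactness implies reflection.** Identify the structure `M` of size `λ` with `λ`, so that
the members of `P_κ λ` become subsets of `M`. Normality says that a choice of a tuple from almost
every set is almost everywhere constant, and consequently that a choice of a relation on almost
every set is almost everywhere the trace of a single relation on `M`
(`IsNormalFineFamily.exists_relation`). So an induction on second-order formulas shows that a
formula holds in `M` if and only if it holds in almost every substructure given by the measure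
(`SOFormula.realize_iff_eventually`). Likewise almost every set is closed under the fewer than `κ`
Skolem functions, hence is an elementary substructure, and meets `κ` in an initial segment
(`IsNormalFineFamily.eventually_initialSegment`). Almost every set therefore reflects the sentence.

**Reflection implies supercompactness.** Suppose that there is no normal fine measure. Take a
structure whose elements code the elements of `λ`, the subsets of `P_κ λ` and the functions from
`P_κ λ` to `λ`, with function symbols for the needed operations on codes; there are at most
`2 ^ (λ ^< κ)` objects to be coded. Its `Π¹₁` sentence "no predicate on the codes of sets is a normal
fine ultrafilter concentrating on the sets that meet `κ` in an initial segment" is true, since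
such an ultrafilter is automatically `κ`-complete (`IsNormalFineFamily.cardinalInterFilter`). Reflect
it to a substructure `m`, and let `s` be the trace of `m` on `λ`. The codes in `m` of sets containing
`s` satisfy, within `m`, all the axioms of such an ultrafilter (`codesMeasure_principal`), a
contradiction. Uncountability of `κ` holds because finite elementary substructures are never proper.
-/

/-! ### Normal fine families of subsets -/

/-- A family of subsets `S i` of `M` that is fine and normal with respect to the ultrafilter `U` on
its index set: each point of `M` lies in almost every `S i`, and a function choosing an element of
almost every `S i` is almost everywhere constant. -/
structure IsNormalFineFamily {ι : Type v} {M : Type w} (U : Ultrafilter ι) (S : ι → Set M) :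
    Prop where
  fine : ∀ a : M, ∀ᶠ i in U, a ∈ S i
  normal : ∀ f : ι → M, (∀ᶠ i in U, f i ∈ S i) → ∃ a, ∀ᶠ i in U, f i = a

namespace IsNormalFineFamily

variable {ι : Type v} {M : Type w} {U : Ultrafilter ι} {S : ι → Set M}

theorem congr {S' : ι → Set M} (h : IsNormalFineFamily U S) (hS : ∀ᶠ i in U, S i = S' i) :
    IsNormalFineFamily U S' where
  fine a := by
    filter_upwards [h.fine a, hS] with i hi hSi
    rwa [← hSi]
  normal f hf := h.normal f <| by
    filter_upwards [hf, hS] with i hi hSi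
    rwa [hSi]

theorem image {M' : Type*} (g : M ≃ M') (h : IsNormalFineFamily U S) :
    IsNormalFineFamily U fun i => g '' S i where
  fine a := by
    filter_upwards [h.fine (g.symm a)] with i hi
    exact ⟨_, hi, g.apply_symm_apply a⟩
  normal f hf := by
    obtain ⟨a, ha⟩ := h.normal (fun i => g.symm (f i)) <| by
      filter_upwards [hf] with i hi
      obtain ⟨x, hx, hxi⟩ := hi
      simpa [← hxi] using hx
    refine ⟨g a, ?_⟩
    filter_upwards [ha] with i hi
    simp [← hi]

theorem eventually_forall_mem (h : IsNormalFineFamily U S) {k : ℕ} (x : Fin k → M) :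
    ∀ᶠ i in U, ∀ j, x j ∈ S i :=
  Filter.eventually_all.2 fun j => h.fine (x j)

/-- If almost every `S i` contains the entries of a tuple with the property `P i`, then a single
tuple works almost everywhere. -/
theorem exists_eventually_tuple (h : IsNormalFineFamily U S) {k : ℕ}
    {P : ι → (Fin k → M) → Prop} (hP : ∀ᶠ i in U, ∃ x : Fin k → M, (∀ j, x j ∈ S i) ∧ P i x) :
    ∃ x : Fin k → M, ∀ᶠ i in U, P i x := by
  obtain ⟨f, hf⟩ := hP.choice
  choose x hx using fun j => h.normal (fun i => f i j) (hf.mono fun i hi => hi.1 j)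
  refine ⟨x, ?_⟩
  filter_upwards [hf, Filter.eventually_all.2 hx] with i hi hxi
  rw [← funext hxi]
  exact hi.2

theorem exists_eventually (h : IsNormalFineFamily U S) {P : ι → M → Prop}
    (hP : ∀ᶠ i in U, ∃ x ∈ S i, P i x) : ∃ x : M, ∀ᶠ i in U, P i x := by
  obtain ⟨f, hf⟩ := hP.choice
  obtain ⟨x, hx⟩ := h.normal f (hf.mono fun i hi => hi.1)
  refine ⟨x, ?_⟩
  filter_upwards [hf, hx] with i hi hxi
  exact hxi ▸ hi.2

theorem eventually_closed (h : IsNormalFineFamily U S) {k : ℕ} (F : (Fin k → M) → M) :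
    ∀ᶠ i in U, ∀ x : Fin k → M, (∀ j, x j ∈ S i) → F x ∈ S i := by
  by_contra hF
  obtain ⟨x, hx⟩ := h.exists_eventually_tuple (P := fun i x => F x ∉ S i) <|
    (Ultrafilter.eventually_not.2 hF).mono fun i hi => by simpa using hi
  obtain ⟨i, hi, hi'⟩ := (hx.and (h.fine (F x))).exists
  exact hi hi'

end IsNormalFineFamily

/-! ### Reflecting second-order truth to almost every substructure -/

section Reflection

open FirstOrder.Language

variable {ι : Type v} {M : Type w} {U : Ultrafilter ι}

/-- The pullback along `f : N → M` of an assignment of relations; for the inclusion of a subset this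
is the assignment of the traces. -/
def RelAssignment.comap {N : Type*} {Γ : List ℕ} (f : N → M) (V : RelAssignment M Γ) :
    RelAssignment N Γ :=
  fun k X => {a | f ∘ a ∈ V k X}

theorem RelAssignment.comap_cons {N : Type*} {Γ : List ℕ} {k : ℕ} (f : N → M)
    (A : Set (Fin k → M)) (V : RelAssignment M Γ) :
    (RelAssignment.cons A V).comap f = RelAssignment.cons {a | f ∘ a ∈ A} (V.comap f) := by
  funext l X
  cases X <;> rfl

/-- A choice of relations on almost all members of a normal fine family is almost everywhere the
trace of a single relation: the entries of a tuple on which they disagree could be chosen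
constant. -/
theorem IsNormalFineFamily.exists_relation {S : ι → Set M} (h : IsNormalFineFamily U S) {k : ℕ}
    (A : ι → Set (Fin k → M)) :
    ∃ B : Set (Fin k → M), ∀ᶠ i in U, ∀ a : Fin k → M, (∀ j, a j ∈ S i) → (a ∈ B ↔ a ∈ A i) := by
  -- The relation must consist of the tuples that lie in almost every `A i`.
  refine ⟨{a | ∀ᶠ i in U, a ∈ A i}, ?_⟩
  by_contra hF
  obtain ⟨a, ha⟩ := h.exists_eventually_tuple
    (P := fun i a => ¬ ((∀ᶠ i in U, a ∈ A i) ↔ a ∈ A i)) <|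
    (Ultrafilter.eventually_not.2 hF).mono fun i hi => by simpa using hi
  by_cases hB : ∀ᶠ i in U, a ∈ A i
  · obtain ⟨i, hi, hi'⟩ := (ha.and hB).exists
    exact hi (iff_of_true hB hi')
  · obtain ⟨i, hi, hi'⟩ := (ha.and (Ultrafilter.eventually_not.2 hB)).exists
    exact hi (iff_of_false hB hi')

variable {L : FirstOrder.Language.{u, u}} [L.Structure M]

theorem FirstOrder.Language.Substructure.coe_realize_term {n : ℕ} {T : L.Substructure M}
    (t : L.Term (Fin n)) {w : Fin n → T} {v : Fin n → M} (hw : ∀ j, (w j : M) = v j) :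
    ((t.realize w : T) : M) = t.realize v := by
  rw [← funext hw]
  exact (HomClass.realize_term T.subtype).symm

/-- The analogue of Łoś's theorem for full second-order logic: a formula holds in `M` if and only if
it holds, for the restricted parameters, in almost every member of a normal fine family of
substructures. The tuple `w` is just `v`, seen in the substructure. -/
theorem SOFormula.realize_iff_eventually {T : ι → L.Substructure M}
    (h : IsNormalFineFamily U fun i => (T i : Set M)) {Γ : List ℕ} {n : ℕ} (φ : SOFormula L Γ n)
    (V : RelAssignment M Γ) (v : Fin n → M) :
    φ.Realize M V v ↔ ∀ᶠ i in U, ∀ w : Fin n → T i, (∀ j, (w j : M) = v j) →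
      φ.Realize (T i) (V.comap ((↑) : T i → M)) w := by
  have lift : ∀ {n : ℕ} (v : Fin n → M), ∀ᶠ i in U, ∃ w : Fin n → T i, ∀ j, (w j : M) = v j :=
    fun v => (h.eventually_forall_mem v).mono fun i hi => ⟨fun j => ⟨v j, hi j⟩, fun j => rfl⟩
  induction φ with
  | falsum =>
    refine ⟨False.elim, fun hφ => ?_⟩
    obtain ⟨i, hi, w, hw⟩ := (hφ.and (lift v)).exists
    exact hi w hw
  | equal t₁ t₂ =>
    have key : ∀ (i : ι) (w : Fin _ → T i), (∀ j, (w j : M) = v j) →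
        (t₁.realize w = t₂.realize w ↔ t₁.realize v = t₂.realize v) := fun i w hw => by
      rw [← Substructure.coe_realize_term t₁ hw, ← Substructure.coe_realize_term t₂ hw,
        Subtype.ext_iff]
    refine ⟨fun hφ => .of_forall fun i w hw => (key i w hw).2 hφ, fun hφ => ?_⟩
    obtain ⟨i, hi, w, hw⟩ := (hφ.and (lift v)).exists
    exact (key i w hw).1 (hi w hw)
  | rel R ts =>
    have key : ∀ (i : ι) (w : Fin _ → T i), (∀ j, (w j : M) = v j) →
        (FirstOrder.Language.Structure.RelMap R (fun j => (ts j).realize w) ↔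
          FirstOrder.Language.Structure.RelMap R fun j => (ts j).realize v) := fun i w hw => by
      simp only [← Substructure.coe_realize_term _ hw]
      exact ((T i).subtype.map_rel R _).symm
    refine ⟨fun hφ => .of_forall fun i w hw => (key i w hw).2 hφ, fun hφ => ?_⟩
    obtain ⟨i, hi, w, hw⟩ := (hφ.and (lift v)).exists
    exact (key i w hw).1 (hi w hw)
  | var X ts =>
    have key : ∀ (i : ι) (w : Fin _ → T i), (∀ j, (w j : M) = v j) →
        ((fun j => (ts j).realize w) ∈ V.comap ((↑) : T i → M) _ X ↔
          (fun j => (ts j).realize v) ∈ V _ X) := fun i w hw => by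
      simp only [← Substructure.coe_realize_term _ hw]
      rfl
    refine ⟨fun hφ => .of_forall fun i w hw => (key i w hw).2 hφ, fun hφ => ?_⟩
    obtain ⟨i, hi, w, hw⟩ := (hφ.and (lift v)).exists
    exact (key i w hw).1 (hi w hw)
  | imp φ ψ ihφ ihψ =>
    constructor
    · intro hφψ
      by_cases hφ : φ.Realize M V v
      · filter_upwards [(ihψ V v).1 (hφψ hφ)] with i hi w hw _ using hi w hw
      · replace hφ := Ultrafilter.eventually_not.2 (mt (ihφ V v).2 hφ)
        filter_upwards [hφ] with i hi w hw hw'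
        refine absurd (fun w' hw'' => ?_) hi
        obtain rfl : w' = w := funext fun j => Subtype.ext ((hw'' j).trans (hw j).symm)
        exact hw'
    · intro hφψ hφ
      replace hφ := (ihφ V v).1 hφ
      refine (ihψ V v).2 ?_
      filter_upwards [hφψ, hφ] with i hi hi' w hw using hi w hw (hi' w hw)
  | all φ ih =>
    constructor
    · intro hφ
      by_contra hF
      obtain ⟨x, hx⟩ := h.exists_eventually (P := fun i x => ∃ w : Fin _ → T i,
        (∀ j, (w j : M) = v j) ∧ ∃ x' : T i, (x' : M) = x ∧
          ¬ φ.Realize (T i) (V.comap ((↑) : T i → M)) (Fin.snoc w x')) <| by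
        filter_upwards [Ultrafilter.eventually_not.2 hF] with i hi
        simp only [SOFormula.Realize, not_forall] at hi
        obtain ⟨w, hw, x, hx⟩ := hi
        exact ⟨x, x.2, w, hw, x, rfl, hx⟩
      obtain ⟨i, ⟨w, hw, x', hx', hn⟩, hi⟩ := (hx.and ((ih V (Fin.snoc v x)).1 (hφ x))).exists
      refine hn (hi _ fun j => ?_)
      refine Fin.lastCases ?_ (fun j => ?_) j
      · simpa using hx'
      · simpa using hw j
    · intro hφ x
      refine (ih _ _).2 ?_
      filter_upwards [hφ] with i hi w hw
      have := hi (Fin.init w) (fun j => by simpa [Fin.init] using hw j.castSucc) (w (Fin.last _))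
      rwa [Fin.snoc_init_self] at this
  | allRel k φ ih =>
    constructor
    · intro hφ
      by_contra hF
      have hA : ∀ᶠ i in U, ∃ A : Set (Fin k → M), ∃ w : Fin _ → T i, (∀ j, (w j : M) = v j) ∧
          ¬ φ.Realize (T i) (RelAssignment.cons {a | (↑) ∘ a ∈ A} (V.comap ((↑) : T i → M))) w := by
        filter_upwards [Ultrafilter.eventually_not.2 hF] with i hi
        simp only [SOFormula.Realize, not_forall] at hi
        obtain ⟨w, hw, A, hA⟩ := hi
        refine ⟨(fun a j => (a j : M)) '' A, w, hw, ?_⟩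
        have hinj : Function.Injective fun (a : Fin k → T i) j => (a j : M) :=
          fun a b hab => funext fun j => Subtype.ext (congrFun hab j)
        rwa [show {a | (↑) ∘ a ∈ (fun (a : Fin k → T i) j => (a j : M)) '' A} = A from
          hinj.preimage_image A]
      obtain ⟨A, hA⟩ := hA.choice
      obtain ⟨B, hB⟩ := h.exists_relation A
      obtain ⟨i, ⟨⟨w, hw, hn⟩, hBA⟩, hi⟩ :=
        ((hA.and hB).and ((ih (RelAssignment.cons B V) v).1 (hφ B))).exists
      refine hn ?_
      have := hi w hw
      rw [RelAssignment.comap_cons] at this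
      rwa [show {a : Fin k → T i | (↑) ∘ a ∈ B} = {a | (↑) ∘ a ∈ A i} from
        Set.ext fun a => hBA _ fun j => (a j).2] at this
    · intro hφ A
      refine (ih _ _).2 ?_
      filter_upwards [hφ] with i hi w hw
      rw [RelAssignment.comap_cons]
      exact hi w hw _

theorem SOSentence.eventually_holds {T : ι → L.Substructure M}
    (h : IsNormalFineFamily U fun i => (T i : Set M)) {φ : SOSentence L} (hφ : φ.Holds M) :
    ∀ᶠ i in U, φ.Holds (T i) := by
  filter_upwards [(SOFormula.realize_iff_eventually h φ _ _).1 hφ] with i hi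
  have := hi Fin.elim0 fun j => j.elim0
  rwa [show (RelAssignment.empty M).comap ((↑) : T i → M) = RelAssignment.empty (T i) from
    funext fun k => funext fun X => nomatch X] at this

end Reflection

/-- A normal fine measure concentrates on the sets meeting an embedded copy of `κ` in an initial
segment. Otherwise almost every set contains some `e α` and omits some `e γ` with `γ < α`; then `α`
can be chosen constant, but almost every set contains all `e γ` with `γ < α`, as there are fewer
than `κ` of them. -/
theorem IsNormalFineFamily.eventually_initialSegment {ι M : Type u} {U : Ultrafilter ι}
    {S : ι → Set M} (h : IsNormalFineFamily U S) {κ : Cardinal.{u}}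
    (hU : CardinalInterFilter (U : Filter ι) κ) (hS : ∀ᶠ i in U, #(S i) < κ)
    (e : κ.ord.ToType ↪ M) :
    ∀ᶠ i in U, ∃ β, ∀ α, e α ∈ S i ↔ α < β := by
  have key : ∀ᶠ i in U, ∀ α, e α ∈ S i → ∀ γ < α, e γ ∈ S i := by
    by_contra hF
    obtain ⟨x, hx⟩ := h.exists_eventually
      (P := fun i x => ∃ α, e α = x ∧ ∃ γ < α, e γ ∉ S i) <| by
      filter_upwards [Ultrafilter.eventually_not.2 hF] with i hi
      push Not at hi
      obtain ⟨α, hα, γ, hγ⟩ := hi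
      exact ⟨e α, hα, α, rfl, γ, hγ⟩
    obtain ⟨i₀, α, rfl, -⟩ := hx.exists
    have hα : #(Set.Iio α) < κ := by simpa using mk_Iio_lt α
    have := (Filter.eventually_cardinal_forall (l := (U : Filter ι)) hα
      (p := fun i (γ : Set.Iio α) => e γ ∈ S i)).2 fun γ => h.fine _
    obtain ⟨i, ⟨α', hα', γ, hγ, hγi⟩, hi⟩ := (hx.and this).exists
    obtain rfl := e.injective hα'
    exact hγi (hi ⟨γ, hγ⟩)
  filter_upwards [key, hS] with i hi hSi
  have hne : ∃ γ, e γ ∉ S i := by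
    by_contra! hall
    refine hSi.not_ge ?_
    have := mk_le_of_injective (f := fun α => (⟨e α, hall α⟩ : S i))
      fun α β hαβ => e.injective (congrArg Subtype.val hαβ)
    rwa [mk_ord_toType] at this
  -- The required bound is the least `β` with `e β ∉ S i`.
  refine ⟨wellFounded_lt.min {γ | e γ ∉ S i} hne, fun α => ⟨fun hα => ?_, fun hα => ?_⟩⟩
  · by_contra! hle
    refine wellFounded_lt.min_mem {γ | e γ ∉ S i} hne ?_
    rcases hle.eq_or_lt with heq | hlt
    · rwa [heq]
    · exact hi α hα _ hlt
  · by_contra hn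
    exact wellFounded_lt.not_lt_min {γ | e γ ∉ S i} hn hα

/-! ### From supercompactness to reflection -/

open FirstOrder.Language in
theorem IsSupercompact.isSecondOrderReflective {κ lam : Cardinal.{u}} (hlam : κ ≤ lam)
    (h : IsSupercompact κ lam) : IsSecondOrderReflective κ lam := by
  obtain ⟨hκ, U, hU⟩ := h
  intro L hL M _ hM e φ _ hφ
  have := hU.complete
  have : Nonempty M := mk_ne_zero_iff.1 (hM ▸ ((aleph0_pos.trans hκ).trans_le hlam).ne')
  obtain ⟨g⟩ : Nonempty (lam.ord.ToType ≃ M) := Cardinal.eq.1 (by rw [mk_ord_toType, hM])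
  have hS : IsNormalFineFamily U fun s : PKappa κ lam => g '' s.1 :=
    IsNormalFineFamily.image g ⟨hU.fine, hU.normal⟩
  -- Almost every set is closed under Skolem functions, hence an elementary substructure.
  let T : PKappa κ lam → L.ElementarySubstructure M := fun s =>
    (Substructure.closure (L.sum L.skolem₁) (g '' s.1)).elementarySkolem₁Reduct
  have hST : ∀ᶠ s : PKappa κ lam in U, g '' s.1 = (T s : Set M) := by
    have := (Filter.eventually_cardinal_forall (l := (U : Filter (PKappa κ lam))) (c := κ)
      (ι := Σ n, (L.sum L.skolem₁).Functions n)
      (p := fun s F => ∀ x : Fin F.1 → M, (∀ j, x j ∈ g '' s.1) →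
        FirstOrder.Language.Structure.funMap F.2 x ∈ g '' s.1)
      (card_functions_sum_skolem₁_le.trans_lt (max_lt hκ hL))).2 fun F => hS.eventually_closed _
    filter_upwards [this] with s hs
    refine Set.Subset.antisymm Substructure.subset_closure ?_
    let T' : (L.sum L.skolem₁).Substructure M := ⟨g '' s.1, fun {n} f => fun x hx => hs ⟨n, f⟩ x hx⟩
    exact (Substructure.closure_le (S := T')).2 subset_rfl
  have hT : IsNormalFineFamily U fun s => (T s : Set M) := hS.congr hST
  have hcard : ∀ᶠ s : PKappa κ lam in U, #(T s) < κ := by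
    filter_upwards [hST] with s hs
    have := mk_image_le (f := g) (s := s.1)
    rw [hs] at this
    exact this.trans_lt s.2
  obtain ⟨s, ⟨hs₁, hs₂⟩, hs₃⟩ := ((SOSentence.eventually_holds
    (T := fun s => (T s).toSubstructure) hT hφ).and hcard).and
      (hT.eventually_initialSegment hU.complete hcard e) |>.exists
  exact ⟨T s, hs₁, hs₂, hs₃⟩

/-! ### Cardinal arithmetic of `P_κ λ` -/

theorem exists_mk_Iio_eq {κ c : Cardinal.{u}} (h : c < κ) :
    ∃ γ : κ.ord.ToType, #(Set.Iio γ) = c := by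
  refine ⟨Ordinal.ToType.mk ⟨c.ord, ord_lt_ord.2 h⟩, ?_⟩
  have := congrArg Ordinal.card (Ordinal.typein_enum (α := κ.ord.ToType) (· < ·)
    (show c.ord < _ by rw [Ordinal.type_toType]; exact ord_lt_ord.2 h))
  rw [card_ord] at this
  exact this

theorem le_powerlt_self {κ lam : Cardinal.{u}} (hκ : 1 < κ) : lam ≤ lam ^< κ := by
  simpa using le_powerlt lam hκ

theorem mk_PKappa_le {κ lam : Cardinal.{u}} (hκ : ℵ₀ < κ) (hlam : κ ≤ lam) :
    #(PKappa κ lam) ≤ lam ^< κ := by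
  have hinf : ℵ₀ ≤ lam := hκ.le.trans hlam
  have hle : lam ≤ lam ^< κ := le_powerlt_self (one_lt_aleph0.trans hκ)
  have hcover : {s : Set lam.ord.ToType | #s < κ} ⊆
      ⋃ γ : κ.ord.ToType, {s | #s ≤ #(Set.Iio γ)} := fun s hs => by
    obtain ⟨γ, hγ⟩ := exists_mk_Iio_eq (show #s < κ from hs)
    exact Set.mem_iUnion.2 ⟨γ, hγ.ge⟩
  refine (mk_le_mk_of_subset hcover).trans ((mk_iUnion_le _).trans ?_)
  rw [mk_ord_toType]
  refine (mul_le_mul' (hlam.trans hle) (ciSup_le' fun γ => ?_)).trans_eq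
    (mul_eq_self (hinf.trans hle))
  change #{s : Set lam.ord.ToType // #s ≤ #(Set.Iio γ)} ≤ _
  refine (mk_bounded_set_le _ _).trans ?_
  rw [mk_ord_toType, max_eq_left hinf]
  exact le_powerlt _ (by simpa using mk_Iio_lt γ)

/-! ### Completeness from normality -/

/-- A normal fine ultrafilter concentrating on the sets that meet a copy of `κ` in an initial segment
is `κ`-complete. If almost every set `t` were outside some member of a family indexed by the ordinals
below `γ < κ`, then, as almost every `t` contains these ordinals, a choice of such a member would be
a regressive function, hence constant almost everywhere. -/
theorem IsNormalFineFamily.cardinalInterFilter {ι M : Type u} {U : Ultrafilter ι} {S : ι → Set M}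
    (h : IsNormalFineFamily U S) {κ : Cardinal.{u}} (j : κ.ord.ToType ↪ M)
    (hj : ∀ᶠ i in U, ∃ β, ∀ α, j α ∈ S i ↔ α < β) : CardinalInterFilter (U : Filter ι) κ := by
  refine ⟨fun C hC hCU => ?_⟩
  obtain ⟨γ, hγ⟩ := exists_mk_Iio_eq hC
  obtain ⟨g⟩ := Cardinal.eq.1 hγ
  by_contra hF
  obtain ⟨x, hx⟩ := h.exists_eventually
    (P := fun i x => ∃ δ : Set.Iio γ, j δ = x ∧ i ∉ (g δ : Set ι)) <| by
    filter_upwards [Ultrafilter.compl_mem_iff_notMem.2 hF, hj, h.fine (j γ)] with i hi hβ hiγ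
    obtain ⟨β, hβ⟩ := hβ
    simp only [Set.mem_compl_iff, Set.mem_sInter, not_forall] at hi
    obtain ⟨A, hA, hiA⟩ := hi
    refine ⟨j (g.symm ⟨A, hA⟩), (hβ _).2 ?_, g.symm ⟨A, hA⟩, rfl, by simpa using hiA⟩
    exact (g.symm ⟨A, hA⟩).2.trans ((hβ γ).1 hiγ)
  obtain ⟨-, δ, rfl, -⟩ := hx.exists
  obtain ⟨i, ⟨δ', hδ', hi⟩, hi'⟩ := (hx.and (hCU _ (g δ).2)).exists
  obtain rfl : δ' = δ := Subtype.ext (j.injective hδ')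
  exact hi hi'

/-! ### The structure coding measures -/

/-- A coding of the elements of `A` by elements of `M`; every element of `M` is the code of
something, although not necessarily the chosen one. Thus one set `M` can carry codings of several
types at once, with no need for sorts. -/
structure Coding (A M : Type u) where
  code : A → M
  decode : M → A
  decode_code : ∀ a, decode (code a) = a

attribute [simp] Coding.decode_code

theorem Coding.nonempty_of_mk_le {A M : Type u} [Nonempty A] (h : #A ≤ #M) :
    Nonempty (Coding A M) := by
  obtain ⟨f⟩ := h
  exact ⟨f, Function.invFun f, Function.leftInverse_invFun f.injective⟩

/-- Function symbols for the operations on codes needed to express that a predicate on codes of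
subsets of `P` is a normal fine measure. The symbol `normalize`, replacing a code of an element by
the chosen code, does not occur in that axiomatization; it ensures that a substructure contains the
chosen code of every element that one of its members codes. -/
inductive MeasureFunctions : ℕ → Type u
  | initial : MeasureFunctions 0
  | compl : MeasureFunctions 1
  | cone : MeasureFunctions 1
  | regressive : MeasureFunctions 1
  | normalize : MeasureFunctions 1
  | inter : MeasureFunctions 2
  | fiber : MeasureFunctions 2

/-- The language with the function symbols `MeasureFunctions` and no relation symbols. -/
abbrev measureLanguage : FirstOrder.Language.{u, u} := ⟨MeasureFunctions, fun _ => PEmpty⟩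

theorem measureLanguage_card_le : measureLanguage.{u}.card ≤ ℵ₀ := by
  have : ∀ n, Countable (measureLanguage.{u}.Functions n) := fun n => by
    refine Function.Injective.countable (f := fun F : MeasureFunctions n => F.ctorIdx) ?_
    rintro (_ | _) (_ | _) h <;> first | rfl | simp [MeasureFunctions.ctorIdx] at h
  have : ∀ n, Countable (measureLanguage.{u}.Relations n) := fun n =>
    inferInstanceAs (Countable PEmpty)
  exact mk_le_aleph0_iff.2 inferInstance

open FirstOrder.Language.Structure (funMap)

/-- The predicate `U` satisfies, on the codes available in `N`, the axioms of a normal fine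
ultrafilter containing a distinguished set. -/
structure CodesMeasure {N : Type u} [measureLanguage.{u}.Structure N] (U : N → Prop) : Prop where
  initial : U (funMap (L := measureLanguage.{u}) MeasureFunctions.initial ![])
  compl_of_not : ∀ x, ¬ U x → U (funMap (L := measureLanguage.{u}) MeasureFunctions.compl ![x])
  not_of_compl : ∀ x, U (funMap (L := measureLanguage.{u}) MeasureFunctions.compl ![x]) → ¬ U x
  inter : ∀ x y, U x → U y →
    U (funMap (L := measureLanguage.{u}) MeasureFunctions.inter ![x, y])
  right_of_inter : ∀ x y,
    U (funMap (L := measureLanguage.{u}) MeasureFunctions.inter ![x, y]) → U y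
  cone : ∀ x, U (funMap (L := measureLanguage.{u}) MeasureFunctions.cone ![x])
  fiber : ∀ x, U (funMap (L := measureLanguage.{u}) MeasureFunctions.regressive ![x]) →
    ∃ y, U (funMap (L := measureLanguage.{u}) MeasureFunctions.fiber ![x, y])

namespace SOFormula

variable {L : FirstOrder.Language.{u, v}} {Γ : List ℕ} {n : ℕ}

/-- Negation. -/
def neg (φ : SOFormula L Γ n) : SOFormula L Γ n := φ.imp falsum

/-- Conjunction. -/
def and (φ ψ : SOFormula L Γ n) : SOFormula L Γ n := (φ.imp ψ.neg).neg

theorem realize_neg {M : Type w} [L.Structure M] {φ : SOFormula L Γ n} {V : RelAssignment M Γ}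
    {x : Fin n → M} : φ.neg.Realize M V x ↔ ¬ φ.Realize M V x :=
  Iff.rfl

theorem realize_and {M : Type w} [L.Structure M] {φ ψ : SOFormula L Γ n} {V : RelAssignment M Γ}
    {x : Fin n → M} : (φ.and ψ).Realize M V x ↔ φ.Realize M V x ∧ ψ.Realize M V x :=
  show ¬ (_ → ¬ _) ↔ _ from Classical.not_imp.trans (and_congr_right fun _ => not_not)

/-- The innermost relation variable, of arity one, applied to a term. -/
def holdsAt (t : L.Term (Fin n)) : SOFormula L (1 :: Γ) n := var .zero ![t]

end SOFormula

/-! ### The sentence denying the existence of a measure -/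

section Sentence

open SOFormula FirstOrder.Language

/-- The term applying a unary function symbol. -/
def unary {n : ℕ} (F : MeasureFunctions.{u} 1) (t : measureLanguage.{u}.Term (Fin n)) :
    measureLanguage.{u}.Term (Fin n) :=
  Functions.apply₁ (L := measureLanguage) F t

/-- The term applying a binary function symbol. -/
def binary {n : ℕ} (F : MeasureFunctions.{u} 2) (t₁ t₂ : measureLanguage.{u}.Term (Fin n)) :
    measureLanguage.{u}.Term (Fin n) :=
  Functions.apply₂ (L := measureLanguage) F t₁ t₂

/-- The axioms `CodesMeasure` for the unary relation variable. -/
def measureAxioms : SOFormula measureLanguage.{u} [1] 0 :=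
  (holdsAt (Constants.term (L := measureLanguage) MeasureFunctions.initial)).and <|
  (all <| (neg (holdsAt (Term.var 0))).imp (holdsAt (unary .compl (Term.var 0)))).and <|
  (all <| (holdsAt (unary .compl (Term.var 0))).imp (neg (holdsAt (Term.var 0)))).and <|
  (all <| all <| (holdsAt (Term.var 0)).imp <| (holdsAt (Term.var 1)).imp
    (holdsAt (binary .inter (Term.var 0) (Term.var 1)))).and <|
  (all <| all <| (holdsAt (binary .inter (Term.var 0) (Term.var 1))).imp
    (holdsAt (Term.var 1))).and <|
  (all <| holdsAt (unary .cone (Term.var 0))).and <|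
  all <| (holdsAt (unary .regressive (Term.var 0))).imp <|
    neg <| all <| neg <| holdsAt (binary .fiber (Term.var 0) (Term.var 1))

/-- The `Π¹₁` sentence saying that there is no measure. -/
def noMeasureSentence : SOSentence measureLanguage.{u} :=
  .allRel 1 measureAxioms.neg

theorem isPi11_noMeasureSentence : IsPi11 noMeasureSentence.{u} :=
  .allRel 1 <| .of_isFirstOrder <| by
    simp [measureAxioms, SOFormula.neg, SOFormula.and, SOFormula.holdsAt, IsFirstOrder]

theorem realize_measureAxioms {N : Type u} [measureLanguage.{u}.Structure N]
    (A : Set (Fin 1 → N)) :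
    measureAxioms.Realize N (RelAssignment.cons A (RelAssignment.empty N)) Fin.elim0 ↔
      CodesMeasure fun x => ![x] ∈ A := by
  have holdsAt_iff : ∀ {n : ℕ} (t : measureLanguage.{u}.Term (Fin n)) (v : Fin n → N),
      (holdsAt t).Realize N (RelAssignment.cons A (RelAssignment.empty N)) v ↔
        ![t.realize v] ∈ A := fun t v => by
    rw [show ![t.realize v] = fun i => (![t] i).realize v from
      funext fun i => by fin_cases i; rfl]
    rfl
  have snoc_one : ∀ x : N, Fin.snoc Fin.elim0 x = ![x] := fun x =>
    funext fun i => by fin_cases i; rfl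
  have snoc_two : ∀ x y : N, Fin.snoc ![x] y = ![x, y] := fun x y =>
    funext fun i => by fin_cases i <;> rfl
  have realize_constant : ∀ v : Fin 0 → N,
      (Constants.term (L := measureLanguage) MeasureFunctions.initial).realize v =
        funMap (L := measureLanguage.{u}) MeasureFunctions.initial ![] := fun v =>
    congrArg (funMap (L := measureLanguage.{u}) MeasureFunctions.initial) (Subsingleton.elim _ _)
  have realize_unary : ∀ {n : ℕ} (F : MeasureFunctions.{u} 1)
      (t : measureLanguage.{u}.Term (Fin n)) (v : Fin n → N),
      (unary F t).realize v = funMap (L := measureLanguage.{u}) F ![t.realize v] :=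
    fun F t v => Term.realize_functions_apply₁
  have realize_binary : ∀ {n : ℕ} (F : MeasureFunctions.{u} 2)
      (t₁ t₂ : measureLanguage.{u}.Term (Fin n)) (v : Fin n → N),
      (binary F t₁ t₂).realize v =
        funMap (L := measureLanguage.{u}) F ![t₁.realize v, t₂.realize v] :=
    fun F t₁ t₂ v => Term.realize_functions_apply₂
  simp only [measureAxioms, SOFormula.realize_and, SOFormula.realize_neg, SOFormula.Realize,
    holdsAt_iff, snoc_one, snoc_two, realize_constant, realize_unary, realize_binary,
    Term.realize_var, Matrix.cons_val_zero, Matrix.cons_val_one, not_forall, not_not]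
  exact ⟨fun ⟨h₁, h₂, h₃, h₄, h₅, h₆, h₇⟩ => ⟨h₁, h₂, h₃, h₄, h₅, h₆, h₇⟩,
    fun ⟨h₁, h₂, h₃, h₄, h₅, h₆, h₇⟩ => ⟨h₁, h₂, h₃, h₄, h₅, h₆, h₇⟩⟩

theorem noMeasureSentence_holds_iff {N : Type u} [measureLanguage.{u}.Structure N] :
    noMeasureSentence.Holds N ↔ ∀ U : N → Prop, ¬ CodesMeasure U := by
  refine ⟨fun h U hU => h {a | U (a 0)} ((realize_measureAxioms _).2 hU), fun h A hA => ?_⟩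
  exact h _ ((realize_measureAxioms A).1 hA)

end Sentence

/-! ### Measures on the full structure and on its substructures -/

section CodedMeasure

variable {P A M : Type u}

/-- The structure on a set `M` of codes for elements of `A`, subsets of `P` and functions from `P`
to `A`, where `P` is equipped with a family `S` of subsets of `A` and a distinguished subset `C`. -/
abbrev measureStructure (cA : Coding A M) (cX : Coding (Set P) M) (cF : Coding (P → A) M)
    (S : P → Set A) (C : Set P) : measureLanguage.{u}.Structure M where
  funMap {_} F := match F with
    | .initial => fun _ => cX.code C
    | .compl => fun x => cX.code (cX.decode (x 0))ᶜ
    | .cone => fun x => cX.code {t | cA.decode (x 0) ∈ S t}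
    | .regressive => fun x => cX.code {t | cF.decode (x 0) t ∈ S t}
    | .normalize => fun x => cA.code (cA.decode (x 0))
    | .inter => fun x => cX.code (cX.decode (x 0) ∩ cX.decode (x 1))
    | .fiber => fun x => cX.code {t | cF.decode (x 0) t = cA.decode (x 1)}
  RelMap R := nomatch R

variable {cA : Coding A M} {cX : Coding (Set P) M} {cF : Coding (P → A) M}
  {S : P → Set A} {C : Set P}

/-- On the full set of codes, a predicate satisfying the axioms does code a measure. -/
theorem CodesMeasure.exists_ultrafilter {V : M → Prop}
    (hV : @CodesMeasure M (measureStructure cA cX cF S C) V) :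
    ∃ U : Ultrafilter P, IsNormalFineFamily U S ∧ C ∈ U := by
  let _ := measureStructure cA cX cF S C
  have hinter : ∀ X Y, V (cX.code X) → V (cX.code Y) → V (cX.code (X ∩ Y)) := fun X Y hX hY => by
    simpa [funMap] using hV.inter _ _ hX hY
  have hmono : ∀ X Y, V (cX.code X) → X ⊆ Y → V (cX.code Y) := fun X Y hX hXY =>
    hV.right_of_inter (cX.code X) (cX.code Y) <| by
      simpa [funMap, Set.inter_eq_left.2 hXY] using hX
  have hC : V (cX.code C) := hV.initial
  let F : Filter P :=
    { sets := {X | V (cX.code X)}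
      univ_sets := hmono _ _ hC (Set.subset_univ _)
      sets_of_superset := fun hX hXY => hmono _ _ hX hXY
      inter_sets := fun hX hY => hinter _ _ hX hY }
  have hcompl : ∀ X : Set P, Xᶜ ∉ F ↔ X ∈ F := fun X => by
    have h₁ := hV.compl_of_not (cX.code X)
    have h₂ := hV.not_of_compl (cX.code X)
    simp only [funMap, Matrix.cons_val_zero, Coding.decode_code] at h₁ h₂
    exact ⟨fun h => by_contra fun hX => h (h₁ hX), fun h hX => h₂ hX h⟩
  refine ⟨Ultrafilter.ofComplNotMemIff F hcompl, ⟨fun a => ?_, fun f hf => ?_⟩, hC⟩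
  · have := hV.cone (cA.code a)
    simp only [funMap, Matrix.cons_val_zero, Coding.decode_code] at this
    exact this
  · have := hV.fiber (cF.code f)
    simp only [funMap, Matrix.cons_val_zero, Matrix.cons_val_one, Coding.decode_code] at this
    obtain ⟨y, hy⟩ := this hf
    exact ⟨_, hy⟩

/-- A substructure `m` codes the principal measure at `s`, provided `s` indexes the set of elements
of `A` with code in `m`. This is a fine and normal measure for `m`, as `m` only has cones and
fibers over the elements of `S s`. -/
theorem codesMeasure_principal :
    letI := measureStructure cA cX cF S C
    ∀ (m : measureLanguage.{u}.Substructure M) (s : P) (_ : S s = {a | cA.code a ∈ m})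
      (_ : s ∈ C), CodesMeasure fun x : m => s ∈ cX.decode x := by
  let _ := measureStructure cA cX cF S C
  intro m s hs hC
  have mem_s : ∀ a, a ∈ S s ↔ cA.code a ∈ m := fun a => by rw [hs]; rfl
  have mem_decode : ∀ X, s ∈ cX.decode (cX.code X) ↔ s ∈ X := fun X => by rw [cX.decode_code]
  have hnorm : ∀ x ∈ m, cA.code (cA.decode x) ∈ m := fun x hx =>
    m.fun_mem (MeasureFunctions.normalize : measureLanguage.Functions 1) ![x] fun i => by
      fin_cases i; exact hx
  refine ⟨?_, fun x => ?_, fun x => ?_, fun x y => ?_, fun x y => ?_, fun x => ?_, fun x hx => ?_⟩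
  · exact (mem_decode _).2 hC
  · exact fun hx => (mem_decode _).2 hx
  · exact fun hx => (mem_decode _).1 hx
  · exact fun hx hy => (mem_decode _).2 ⟨hx, hy⟩
  · exact fun h => ((mem_decode _).1 h).2
  · exact (mem_decode _).2 ((mem_s _).2 (hnorm x x.2))
  · exact ⟨⟨_, (mem_s _).1 ((mem_decode _).1 hx)⟩, (mem_decode _).2 (cA.decode_code _).symm⟩

end CodedMeasure

/-! ### From reflection to supercompactness -/

/-- A reflecting cardinal is uncountable: a finite elementary substructure is not proper. -/
theorem IsPi11Reflective.aleph0_lt {κ μ : Cardinal.{u}} (hμ : κ ≤ μ) (hκ : 0 < κ)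
    (h : IsPi11Reflective κ μ) : ℵ₀ < κ := by
  by_contra! hle
  let L : FirstOrder.Language.{u, u} := ⟨fun _ => PEmpty, fun _ => PEmpty⟩
  let _ : L.Structure μ.out := ⟨fun {_} f _ => PEmpty.elim f, fun {_} r _ => PEmpty.elim r⟩
  have hL : L.card < κ := by
    have : IsEmpty L.Symbols := ⟨by rintro (⟨_, ⟨⟩⟩ | ⟨_, ⟨⟩⟩)⟩
    rwa [FirstOrder.Language.card, mk_eq_zero]
  obtain ⟨e⟩ : Nonempty (κ.ord.ToType ↪ μ.out) := by
    rw [← Cardinal.le_def, mk_ord_toType, mk_out]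
    exact hμ
  obtain ⟨m, -, hm, -⟩ := h L hL μ.out (mk_out μ) e (.imp .falsum .falsum)
    (.of_isFirstOrder ⟨trivial, trivial⟩) id
  -- The sentence "there are more than `n` elements" separates `m` from the full structure.
  obtain ⟨n, hn⟩ := lt_aleph0.1 (hm.trans_le hle)
  have key := m.realize_sentence (FirstOrder.Language.Sentence.cardGe L (n + 1))
  rw [FirstOrder.Language.Sentence.realize_cardGe, FirstOrder.Language.Sentence.realize_cardGe,
    mk_out, hn] at key
  refine (key.2 ?_).not_gt (by exact_mod_cast Nat.lt_succ_self n)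
  rw [Nat.cast_add, Nat.cast_one, ← Cardinal.succ_natCast, ← hn]
  exact Order.succ_le_of_lt (hm.trans_le hμ)

theorem IsPi11Reflective.isSupercompact {κ lam : Cardinal.{u}} (hκ : 0 < κ) (hlam : κ ≤ lam)
    (h : IsPi11Reflective κ (2 ^ (lam ^< κ))) : IsSupercompact κ lam := by
  -- For `κ = 1` the bound `lam ≤ lam ^< κ` may fail, as then `lam ^< κ = 1`.
  have hμ : κ ≤ 2 ^ (lam ^< κ) := by
    rcases (Cardinal.one_le_iff_pos.2 hκ).eq_or_lt with rfl | h1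
    · exact Cardinal.one_le_iff_pos.2 (power_pos _ two_pos)
    · exact (hlam.trans (le_powerlt_self h1)).trans (cantor _).le
  have hω := h.aleph0_lt hμ hκ
  refine ⟨hω, ?_⟩
  have hP := mk_PKappa_le hω hlam
  have hinf : ℵ₀ ≤ lam := hω.le.trans hlam
  have hle : lam ≤ lam ^< κ := le_powerlt_self (one_lt_aleph0.trans hω)
  have : Nonempty lam.ord.ToType :=
    mk_ne_zero_iff.1 (by rw [mk_ord_toType]; exact (aleph0_pos.trans_le hinf).ne')
  let M : Type u := (2 ^ (lam ^< κ) : Cardinal.{u}).out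
  have hM : #M = 2 ^ (lam ^< κ) := mk_out _
  obtain ⟨cA⟩ : Nonempty (Coding lam.ord.ToType M) := Coding.nonempty_of_mk_le <| by
    rw [mk_ord_toType, hM]
    exact hle.trans (cantor _).le
  obtain ⟨cX⟩ : Nonempty (Coding (Set (PKappa κ lam)) M) := Coding.nonempty_of_mk_le <| by
    rw [mk_set, hM]
    exact power_le_power_left two_ne_zero hP
  obtain ⟨cF⟩ : Nonempty (Coding (PKappa κ lam → lam.ord.ToType) M) :=
      Coding.nonempty_of_mk_le <| by
    rw [mk_arrow, lift_id, lift_id, mk_ord_toType, hM]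
    calc lam ^ #(PKappa κ lam) ≤ (2 ^ lam) ^ (lam ^< κ) :=
          (power_le_power_right (cantor _).le).trans
            (power_le_power_left (power_ne_zero _ two_ne_zero) hP)
      _ = 2 ^ (lam ^< κ) := by
          rw [← power_mul, mul_eq_right (hinf.trans hle) hle (aleph0_pos.trans_le hinf).ne']
  obtain ⟨j⟩ : Nonempty (κ.ord.ToType ↪ lam.ord.ToType) := by
    rw [← Cardinal.le_def, mk_ord_toType, mk_ord_toType]
    exact hlam
  let C : Set (PKappa κ lam) := {t | ∃ β, ∀ α, j α ∈ t.1 ↔ α < β}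
  let _ := measureStructure cA cX cF (fun t : PKappa κ lam => t.1) C
  by_contra hno
  -- As there is no normal fine measure, the sentence saying so is true and can be reflected.
  have hφ : noMeasureSentence.Holds M := noMeasureSentence_holds_iff.2 fun V hV => by
    obtain ⟨U, hU, hCU⟩ := hV.exists_ultrafilter
    exact hno ⟨U, hU.cardinalInterFilter j hCU, hU.fine, hU.normal⟩
  have hcode : Function.Injective cA.code := Function.LeftInverse.injective cA.decode_code
  obtain ⟨m, hm, hmκ, β, hβ⟩ := h measureLanguage (measureLanguage_card_le.trans_lt hω) M hM
    (j.trans ⟨cA.code, hcode⟩) _ isPi11_noMeasureSentence hφ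
  -- However, `m` has a measure, namely the principal one at its trace on `λ`.
  have hs : #({a | cA.code a ∈ m} : Set lam.ord.ToType) < κ :=
    (mk_le_of_injective (f := fun a : ({a | cA.code a ∈ m} : Set lam.ord.ToType) =>
      (⟨cA.code a, a.2⟩ : m)) fun a b hab =>
        Subtype.ext (hcode (congrArg Subtype.val hab))).trans_lt hmκ
  exact noMeasureSentence_holds_iff.1 hm _
    (codesMeasure_principal (C := C) m.toSubstructure ⟨_, hs⟩ rfl ⟨β, hβ⟩)

theorem mainTheorem2 (κ lam : Cardinal.{u}) (hκ : 0 < κ) (hlam : κ ≤ lam) :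
    (IsSupercompact κ lam → IsSecondOrderReflective κ lam) ∧
      (IsPi11Reflective κ (2 ^ (lam ^< κ)) → IsSupercompact κ lam) :=
  ⟨fun h => h.isSecondOrderReflective hlam, fun h => h.isSupercompact hκ hlam⟩
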